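/- Let $F=\frac1N\sum_{i=1}^N f_i:\mathbb R^d\to\mathbb R$ be bounded below, where every $f_i$ is twice differentiable and $f_i$, $\nabla f_i$, $\nabla^2 f_i$ are Lipschitz with constants $L_0$, $L_1$, $L_2$ respectively (Euclidean norm; spectral norm for Hessians). Let $\alpha,\beta,\epsilon_1,M>0$, $\zeta>0$ and an integer $m\ge1$ be given. Consider the algorithm SVRC started at $x_0$: in iteration $k=0,1,\dots$ put $\tilde x=x_{\lfloor k/m\rfloor m}$; if $m\mid k$, let $g_k=\nabla F(x_k)$ and $H_k=\nabla^2F(x_k)$; otherwise draw mini-batches $\xi_g(k)$, $\xi_H(k)$ of indices from $\{1,\dots,N\}$ and let $$g_k=\frac1{|\xi_g(k)|}\sum_{i\in\xi_g(k)}\bigl(\nabla f_i(x_k)-\nabla f_i(\tilde x)\bigr)+\nabla F(\tilde x),\qquad H_k=\frac1{|\xi_H(k)|}\sum_{i\in\xi_H(k)}\bigl(\nabla^2 f_i(x_k)-\nabla^2 f_i(\tilde x)\bigr)+\nabla^2F(\tilde x);$$ then let $s_{k+1}$ be a global minimizer of $s\mapsto g_k^\top s+\frac12 s^\top H_ks+\frac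 M6\|s\|^3$, put $x_{k+1}=x_k+s_{k+1}$, and stop if $\max\{\|s_{k+1}\|,\|s_k\|\}\le\epsilon_1$ (with $s_0$ an arbitrary initial value). Sampling is with replacement: the sizes $|\xi_g(k)|$ and $|\xi_H(k)|$ are determined by the history up to the start of iteration $k$, and, given this history, the elements of $\xi_g(k)$ are independent and uniform on $\{1,\dots,N\}$, and so are the elements of $\xi_H(k)$. Then the following holds for every $k$. (1) Given the history, on the event that iteration $k$ is executed and (if $m\nmid k$) $$|\xi_g(k)|\ \ge\ \left(\frac{8L_1^2\,\|x_k-\tilde x\|^2}{\beta^2\max\{\|s_k\|^4,\epsilon_1^4\}}+\frac{4L_1\,\|x_k-\tilde x\|}{3\beta\max\{\|s_k\|^2,\epsilon_1^2\}}\right)\log\frac{2(d+1)}{\zeta},$$ the inequality $\|g_k-\nabla F(x_k)\|\le\beta\max\{\|s_k\|^2,\epsilon_1^2\}$ holds with conditional probability at least $1-\zeta$, almost surely. In particular, if the batch-size bound holds almost surely whenever iteration $k$ is executed, then with probability at least $1-\zeta$ iteration $k$, if executed, satisfies this inequality. (2) Given the history, on the event that iteration $k$ is executed and (if $m\nmid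 k$) $$|\xi_H(k)|\ \ge\ \left(\frac{8L_2^2\,\|x_k-\tilde x\|^2}{\alpha^2\max\{\|s_k\|^2,\epsilon_1^2\}}+\frac{4L_2\,\|x_k-\tilde x\|}{3\alpha\max\{\|s_k\|,\epsilon_1\}}\right)\log\frac{4d}{\zeta},$$ the inequality $\|H_k-\nabla^2F(x_k)\|\le\alpha\max\{\|s_k\|,\epsilon_1\}$ holds with conditional probability at least $1-\zeta$, almost surely. In particular, if the batch-size bound holds almost surely whenever iteration $k$ is executed, then with probability at least $1-\zeta$ iteration $k$, if executed, satisfies this inequality. -/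

import Mathlib

open MeasureTheory ProbabilityTheory
open scoped ENNReal NNReal Gradient InnerProductSpace

namespace SVRC

noncomputable section

/-- The space `ℝ^d` with its Euclidean norm. -/
abbrev Vec (d : ℕ) : Type := EuclideanSpace ℝ (Fin d)

/-- The finite-sum objective `F = (1/N) ∑ f_i`. -/
def objective {d N : ℕ} (f : Fin N → Vec d → ℝ) : Vec d → ℝ :=
  fun x => (1 / (N : ℝ)) * ∑ i, f i x

/-- The Hessian at `x`, as the linear operator `v ↦ D(∇φ)(x) v` on `ℝ^d`; its operator norm is
the spectral norm of the Hessian matrix. -/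
def hessian {d : ℕ} (φ : Vec d → ℝ) (x : Vec d) : Vec d →L[ℝ] Vec d :=
  fderiv ℝ (∇ φ) x

/-- Standing assumption on the objective: `F` is bounded below, and every component `f_i` is twice
differentiable, with `f_i`, `∇f_i`, `∇²f_i` Lipschitz with constants `L₀`, `L₁`, `L₂`. -/
structure ObjectiveAssumption {d N : ℕ} (f : Fin N → Vec d → ℝ) (L₀ L₁ L₂ : ℝ≥0) : Prop where
  bddBelow : BddBelow (Set.range (objective f))
  differentiable : ∀ i, Differentiable ℝ (f i)
  differentiable_gradient : ∀ i, Differentiable ℝ (∇ (f i))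
  lipschitz : ∀ i, LipschitzWith L₀ (f i)
  lipschitz_gradient : ∀ i, LipschitzWith L₁ (∇ (f i))
  lipschitz_hessian : ∀ i, LipschitzWith L₂ (hessian (f i))

/-- The variance-reduced gradient
`(1/|ξ|) ∑_{i ∈ ξ} (∇f_i(x) - ∇f_i(x̃)) + ∇F(x̃)`; a mini-batch `ξ` is a list of indices, so an
index drawn several times is counted several times. -/
def vrGradient {d N : ℕ} (f : Fin N → Vec d → ℝ) (x xt : Vec d) (ξ : List (Fin N)) : Vec d :=
  (1 / (ξ.length : ℝ)) • (ξ.map fun i => ∇ (f i) x - ∇ (f i) xt).sum + ∇ (objective f) xt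

/-- The variance-reduced Hessian
`(1/|ξ|) ∑_{i ∈ ξ} (∇²f_i(x) - ∇²f_i(x̃)) + ∇²F(x̃)`. -/
def vrHessian {d N : ℕ} (f : Fin N → Vec d → ℝ) (x xt : Vec d) (ξ : List (Fin N)) :
    Vec d →L[ℝ] Vec d :=
  (1 / (ξ.length : ℝ)) • (ξ.map fun i => hessian (f i) x - hessian (f i) xt).sum
    + hessian (objective f) xt

section Runs

variable {Ω : Type*} {d N : ℕ}

/-- The initial variable `x̃ = x_{⌊k/m⌋·m}` of the inner loop that contains iteration `k`. -/
def anchor (m : ℕ) (x : ℕ → Ω → Vec d) (k : ℕ) (ω : Ω) : Vec d :=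
  x (k / m * m) ω

/-- The gradient `g_k` used by the algorithm: the full gradient at the start of an inner loop,
the variance-reduced mini-batch gradient otherwise. -/
def gradEst (f : Fin N → Vec d → ℝ) (m : ℕ) (x : ℕ → Ω → Vec d) (ξg : ℕ → Ω → List (Fin N))
    (k : ℕ) (ω : Ω) : Vec d :=
  if k % m = 0 then ∇ (objective f) (x k ω)
  else vrGradient f (x k ω) (anchor m x k ω) (ξg k ω)

/-- The Hessian `H_k` used by the algorithm. -/
def hessEst (f : Fin N → Vec d → ℝ) (m : ℕ) (x : ℕ → Ω → Vec d) (ξH : ℕ → Ω → List (Fin N))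
    (k : ℕ) (ω : Ω) : Vec d →L[ℝ] Vec d :=
  if k % m = 0 then hessian (objective f) (x k ω)
  else vrHessian f (x k ω) (anchor m x k ω) (ξH k ω)

/-- The event that iteration `k` is executed: the stopping test
`max {‖s_{j+1}‖, ‖s_j‖} ≤ ε₁` has failed in all iterations `j < k`. -/
def executed (ε₁ : ℝ) (s : ℕ → Ω → Vec d) (k : ℕ) : Set Ω :=
  {ω | ∀ j < k, ε₁ < max ‖s (j + 1) ω‖ ‖s j ω‖}

/-- The cubic-regularized model `u ↦ gᵀu + ½ uᵀHu + (M/6)‖u‖³`. -/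
def cubicModel (M : ℝ) (g : Vec d) (H : Vec d →L[ℝ] Vec d) (u : Vec d) : ℝ :=
  ⟪g, u⟫_ℝ + 1 / 2 * ⟪u, H u⟫_ℝ + M / 6 * ‖u‖ ^ 3

/-- Sampling with replacement, given the history `hist`, on the event `E` of `hist` on which a
sample is taken at all: the batch size is determined by the history, and, given the history, the
`n` elements of a batch of size `n` are independent and uniform on the `N` indices, that is, the
batch equals any given list of length `n` with conditional probability `N^{-n}`. -/
structure SampledWithReplacement [MeasurableSpace Ω] (μ : Measure Ω) (hist : MeasurableSpace Ω)
    (E : Set Ω) (ξ : Ω → List (Fin N)) : Prop where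
  size_measurable : ∀ n : ℕ, MeasurableSet[hist] {ω | (ξ ω).length = n}
  law : ∀ (l : List (Fin N)) (A : Set Ω), MeasurableSet[hist] A → A ⊆ E →
    μ (A ∩ {ω | ξ ω = l})
      = ((N : ℝ≥0∞)⁻¹) ^ l.length * μ (A ∩ {ω | (ξ ω).length = l.length})

/-- `x`, `s` (iterates and steps) and `ξg`, `ξH` (mini-batches) form a run of the algorithm with
initial point `x₀`, inner-loop length `m`, cubic parameter `M` and stopping threshold `ε₁`, under
sampling with replacement. `ℱ k` is the history available when iteration `k` starts. Nothing is
asked of the processes once the algorithm has stopped, apart from measurability; `s_0` is an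
arbitrary initial value, and nothing is assumed on the joint law of the gradient batch and the
Hessian batch of one iteration. -/
structure IsRun [mΩ : MeasurableSpace Ω] (μ : Measure Ω) (ℱ : Filtration ℕ mΩ)
    (f : Fin N → Vec d → ℝ) (x₀ : Vec d) (m : ℕ) (M ε₁ : ℝ)
    (x s : ℕ → Ω → Vec d) (ξg ξH : ℕ → Ω → List (Fin N)) : Prop where
  x_measurable : ∀ k, Measurable[ℱ k] (x k)
  s_measurable : ∀ k, Measurable[ℱ k] (s k)
  ξg_measurable : ∀ k, k % m ≠ 0 → ∀ l, MeasurableSet[ℱ (k + 1)] {ω | ξg k ω = l}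
  ξH_measurable : ∀ k, k % m ≠ 0 → ∀ l, MeasurableSet[ℱ (k + 1)] {ω | ξH k ω = l}
  sample_gradient : ∀ k, k % m ≠ 0 →
    SampledWithReplacement μ (ℱ k) (executed ε₁ s k) (ξg k)
  sample_hessian : ∀ k, k % m ≠ 0 →
    SampledWithReplacement μ (ℱ k) (executed ε₁ s k) (ξH k)
  init : ∀ ω, x 0 ω = x₀
  step_argmin : ∀ k, ∀ ω ∈ executed ε₁ s k,
    IsMinOn (cubicModel M (gradEst f m x ξg k ω) (hessEst f m x ξH k ω)) Set.univ (s (k + 1) ω)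
  step_update : ∀ k, ∀ ω ∈ executed ε₁ s k, x (k + 1) ω = x k ω + s (k + 1) ω

/-- The event that `g_k` meets its inexactness condition
`‖g_k - ∇F(x_k)‖ ≤ β max {‖s_k‖², ε₁²}`. -/
def gradAccurate (f : Fin N → Vec d → ℝ) (m : ℕ) (β ε₁ : ℝ) (x s : ℕ → Ω → Vec d)
    (ξg : ℕ → Ω → List (Fin N)) (k : ℕ) : Set Ω :=
  {ω | ‖gradEst f m x ξg k ω - ∇ (objective f) (x k ω)‖ ≤ β * max (‖s k ω‖ ^ 2) (ε₁ ^ 2)}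

/-- The event that `H_k` meets its inexactness condition
`‖H_k - ∇²F(x_k)‖ ≤ α max {‖s_k‖, ε₁}`. -/
def hessAccurate (f : Fin N → Vec d → ℝ) (m : ℕ) (α ε₁ : ℝ) (x s : ℕ → Ω → Vec d)
    (ξH : ℕ → Ω → List (Fin N)) (k : ℕ) : Set Ω :=
  {ω | ‖hessEst f m x ξH k ω - hessian (objective f) (x k ω)‖ ≤ α * max ‖s k ω‖ ε₁}

/-- The batch-size condition for gradients, asked of the iterations that draw a mini-batch. -/
def gradBatchLarge (m : ℕ) (L₁ : ℝ≥0) (β ε₁ ζ : ℝ) (x s : ℕ → Ω → Vec d)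
    (ξg : ℕ → Ω → List (Fin N)) (k : ℕ) : Set Ω :=
  {ω | k % m ≠ 0 →
    (8 * (L₁ : ℝ) ^ 2 / (β ^ 2 * max (‖s k ω‖ ^ 4) (ε₁ ^ 4)) * ‖x k ω - anchor m x k ω‖ ^ 2
      + 4 * (L₁ : ℝ) / (3 * β * max (‖s k ω‖ ^ 2) (ε₁ ^ 2)) * ‖x k ω - anchor m x k ω‖)
      * Real.log (2 * ((d : ℝ) + 1) / ζ) ≤ ((ξg k ω).length : ℝ)}

/-- The batch-size condition for Hessians, asked of the iterations that draw a mini-batch. -/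
def hessBatchLarge (m : ℕ) (L₂ : ℝ≥0) (α ε₁ ζ : ℝ) (x s : ℕ → Ω → Vec d)
    (ξH : ℕ → Ω → List (Fin N)) (k : ℕ) : Set Ω :=
  {ω | k % m ≠ 0 →
    (8 * (L₂ : ℝ) ^ 2 / (α ^ 2 * max (‖s k ω‖ ^ 2) (ε₁ ^ 2)) * ‖x k ω - anchor m x k ω‖ ^ 2
      + 4 * (L₂ : ℝ) / (3 * α * max ‖s k ω‖ ε₁) * ‖x k ω - anchor m x k ω‖)
      * Real.log (4 * (d : ℝ) / ζ) ≤ ((ξH k ω).length : ℝ)}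

end Runs

end

end SVRC

/-! The error of a variance-reduced estimate is the mean of `n` uniform samples from a finite family
minus the mean of the family, the family being the differences of component gradients (Hessians)
between `x_k` and the anchor. By Lipschitz continuity its members have norm at most `R = L * ‖x_k -
x̃‖`, so after centering at most `2 * R`.

A matrix Hoeffding bound (`card_norm_sum_gt_le`) controls such sums by the trace-exponential method:
Golden–Thompson (`trace_exp_add_le`) splits off one sample at a time, each costing a factor `cosh`.
Hessians are self-adjoint, so it applies to them directly; gradients enter through their Hermitian
dilation in dimension `d + 1`.

Everything is counted over index tuples: for a large enough batch size at most a fraction `ζ` of the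
tuples is bad (`card_mean_deviation_le`). Given the history all tuples of the realized size are
equally likely, so `SampledWithReplacement.measure_inter_le` turns the count into a bound on every
history event, which is the conditional statement. -/

namespace SVRC

open scoped Matrix Matrix.Norms.L2Operator
open Filter Topology

/-! ### Trace inequalities for dyadic powers of products -/

section TraceInequalities

variable {ι : Type*} [Fintype ι] [DecidableEq ι]

lemma trace_mul_pow_comm (X Y : Matrix ι ι ℝ) (m : ℕ) :
    ((X * Y) ^ m).trace = ((Y * X) ^ m).trace := by
  cases m with
  | zero => simp
  | succ m =>
    have h : SemiconjBy X (Y * X) (X * Y) := by simp [SemiconjBy, mul_assoc]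
    rw [pow_succ, ← mul_assoc, ← (h.pow_right m).eq, Matrix.trace_mul_comm, pow_succ', mul_assoc]

omit [DecidableEq ι] in
lemma trace_conjTranspose_mul_self_nonneg (X : Matrix ι ι ℝ) : 0 ≤ (Xᴴ * X).trace :=
  (Matrix.posSemidef_conjTranspose_mul_self X).trace_nonneg

/-- Expand the squared Frobenius norm of `X - Xᴴ`. -/
lemma trace_sq_le (X : Matrix ι ι ℝ) : (X ^ 2).trace ≤ (Xᴴ * X).trace := by
  have h := trace_conjTranspose_mul_self_nonneg (X - Xᴴ)
  have h1 : (Xᴴ * Xᴴ).trace = (X * X).trace := by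
    rw [← Matrix.conjTranspose_mul, Matrix.trace_conjTranspose]; simp
  simp only [Matrix.conjTranspose_sub, Matrix.conjTranspose_conjTranspose, sub_mul, mul_sub,
    Matrix.trace_sub, h1, Matrix.trace_mul_comm X Xᴴ] at h
  rw [pow_two]; linarith

omit [DecidableEq ι] in
lemma two_mul_trace_mul_le {A B : Matrix ι ι ℝ} (hA : A.IsHermitian) (hB : B.IsHermitian) :
    2 * (A * B).trace ≤ (A * A).trace + (B * B).trace := by
  have h := trace_conjTranspose_mul_self_nonneg (A - B)
  simp only [Matrix.conjTranspose_sub, hA.eq, hB.eq, sub_mul, mul_sub,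
    Matrix.trace_sub, Matrix.trace_mul_comm B A] at h
  linarith

/-- Applying `hk` to `P * Q` and rotating the trace replaces `P`, `Q` by their squares and halves
the exponent. The bound `hk` is an assumption because its own inductive proof uses this lemma at
smaller exponents. -/
lemma trace_mul_pow_two_pow_le_of {k : ℕ}
    (hk : ∀ j < k, ∀ X : Matrix ι ι ℝ, (X ^ 2 ^ (j + 1)).trace ≤ ((Xᴴ * X) ^ 2 ^ j).trace)
    {j : ℕ} (hj : j ≤ k) {P Q : Matrix ι ι ℝ} (hP : P.IsHermitian) (hQ : Q.IsHermitian) :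
    ((P * Q) ^ 2 ^ j).trace ≤ (P ^ 2 ^ j * Q ^ 2 ^ j).trace := by
  induction j generalizing P Q with
  | zero => simp
  | succ j ih =>
    calc ((P * Q) ^ 2 ^ (j + 1)).trace ≤ (((P * Q)ᴴ * (P * Q)) ^ 2 ^ j).trace := hk j hj _
      _ = ((P ^ 2 * Q ^ 2) ^ 2 ^ j).trace := by
        rw [Matrix.conjTranspose_mul, hP.eq, hQ.eq, mul_assoc, trace_mul_pow_comm]
        simp only [pow_two, mul_assoc]
      _ ≤ ((P ^ 2) ^ 2 ^ j * (Q ^ 2) ^ 2 ^ j).trace := ih (by omega) (hP.pow 2) (hQ.pow 2)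
      _ = _ := by simp only [← pow_mul, pow_succ' 2 j]

/-- The induction hypothesis for `X ^ 2` leads, after a rotation, to powers of the product of `Xᴴ *
X` and `X * Xᴴ`. Splitting these powers and using `2ab ≤ a² + b²` under the trace closes the step,
since powers of the two factors have equal traces. -/
lemma trace_pow_two_pow_succ_le (k : ℕ) (X : Matrix ι ι ℝ) :
    (X ^ 2 ^ (k + 1)).trace ≤ ((Xᴴ * X) ^ 2 ^ k).trace := by
  induction k using Nat.strong_induction_on generalizing X with
  | _ k ih =>
    cases k with
    | zero => simpa using trace_sq_le X
    | succ k =>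
      have hP : (Xᴴ * X).IsHermitian := Matrix.isHermitian_conjTranspose_mul_self X
      have hQ : (X * Xᴴ).IsHermitian := Matrix.isHermitian_mul_conjTranspose_self X
      have h1 : (X ^ 2 ^ (k + 1 + 1)).trace ≤ (((Xᴴ * X) * (X * Xᴴ)) ^ 2 ^ k).trace := by
        calc (X ^ 2 ^ (k + 1 + 1)).trace = ((X ^ 2) ^ 2 ^ (k + 1)).trace := by
              rw [← pow_mul, ← pow_succ' 2 (k + 1)]
          _ ≤ (((X ^ 2)ᴴ * X ^ 2) ^ 2 ^ k).trace := ih k (by omega) _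
          _ = ((Xᴴ * (Xᴴ * X * X)) ^ 2 ^ k).trace := by
              simp only [pow_two, Matrix.conjTranspose_mul, mul_assoc]
          _ = _ := by rw [trace_mul_pow_comm]; simp only [mul_assoc]
      have h2 := trace_mul_pow_two_pow_le_of (fun j hj => ih j (by omega)) le_rfl hP hQ (k := k)
      have h3 := two_mul_trace_mul_le (hP.pow (2 ^ k)) (hQ.pow (2 ^ k))
      simp only [← pow_add, ← two_mul, ← pow_succ'] at h3
      rw [trace_mul_pow_comm X Xᴴ] at h3
      linarith

lemma trace_mul_pow_two_pow_le (k : ℕ) {P Q : Matrix ι ι ℝ} (hP : P.IsHermitian)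
    (hQ : Q.IsHermitian) : ((P * Q) ^ 2 ^ k).trace ≤ (P ^ 2 ^ k * Q ^ 2 ^ k).trace :=
  trace_mul_pow_two_pow_le_of (fun j _ => trace_pow_two_pow_succ_le j) le_rfl hP hQ

end TraceInequalities

/-! ### Lie product formula -/

section LieTrotter

variable {𝔸 : Type*} [NormedRing 𝔸] [NormOneClass 𝔸]

lemma norm_pow_sub_pow_le {a b : 𝔸} {C : ℝ} (ha : ‖a‖ ≤ C) (hb : ‖b‖ ≤ C) (n : ℕ) :
    ‖a ^ n - b ^ n‖ ≤ n * C ^ (n - 1) * ‖a - b‖ := by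
  have hC : 0 ≤ C := (norm_nonneg a).trans ha
  induction n with
  | zero => simp
  | succ n ih =>
    have h : a ^ (n + 1) - b ^ (n + 1) = a ^ n * (a - b) + (a ^ n - b ^ n) * b := by
      rw [pow_succ, pow_succ]; noncomm_ring
    have h1 : ‖a ^ n * (a - b)‖ ≤ C ^ n * ‖a - b‖ :=
      (norm_mul_le _ _).trans (by gcongr; exact (norm_pow_le a n).trans (by gcongr))
    have h2 : ‖(a ^ n - b ^ n) * b‖ ≤ n * C ^ n * ‖a - b‖ := by
      refine (norm_mul_le _ _).trans ((mul_le_mul ih hb (norm_nonneg _) (by positivity)).trans ?_)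
      cases n with
      | zero => simp
      | succ n => rw [Nat.add_sub_cancel, pow_succ C n]; apply le_of_eq; ring
    rw [h]
    refine (norm_add_le _ _).trans ((add_le_add h1 h2).trans (le_of_eq ?_))
    rw [Nat.add_sub_cancel]; push_cast; ring

variable [NormedAlgebra ℝ 𝔸] [CompleteSpace 𝔸]

omit [CompleteSpace 𝔸] in
lemma norm_exp_le_exp_norm (a : 𝔸) : ‖NormedSpace.exp a‖ ≤ Real.exp ‖a‖ := by
  rw [NormedSpace.exp_eq_tsum ℝ, Real.exp_eq_exp_ℝ]
  refine tsum_of_norm_bounded (NormedSpace.expSeries_div_hasSum_exp ‖a‖) fun n => ?_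
  rw [norm_smul, norm_inv, Real.norm_natCast, inv_mul_eq_div]
  gcongr
  exact norm_pow_le a n

-- Both curves pass through `1` at `t = 0` with derivative `A + B`.
omit [NormOneClass 𝔸] in
lemma isLittleO_exp_mul_exp_sub_exp_add (A B : 𝔸) :
    (fun t : ℝ => NormedSpace.exp (t • A) * NormedSpace.exp (t • B)
      - NormedSpace.exp (t • (A + B))) =o[𝓝 0] (fun t : ℝ => t) := by
  have hd (C : 𝔸) : HasDerivAt (fun t : ℝ => NormedSpace.exp (t • C)) C 0 := by
    simpa using hasDerivAt_exp_smul_const C (0 : ℝ) (𝕂 := ℝ)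
  have h := ((hd A).mul (hd B)).sub (hd (A + B))
  simpa [hasDerivAt_iff_isLittleO] using h

/-- The Lie product formula. -/
lemma tendsto_exp_mul_exp_pow (A B : 𝔸) :
    Tendsto (fun n : ℕ => (NormedSpace.exp ((n : ℝ)⁻¹ • A) * NormedSpace.exp ((n : ℝ)⁻¹ • B)) ^ n)
      atTop (𝓝 (NormedSpace.exp (A + B))) := by
  set D : ℝ → 𝔸 := fun t => NormedSpace.exp (t • A) * NormedSpace.exp (t • B)
      - NormedSpace.exp (t • (A + B))
  have hlim : Tendsto (fun n : ℕ => (n : ℝ) * ‖D (n : ℝ)⁻¹‖) atTop (𝓝 0) := by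
    have h := (isLittleO_exp_mul_exp_sub_exp_add A B).comp_tendsto
      (tendsto_inv_atTop_nhds_zero_nat (𝕜 := ℝ))
    have h' := h.norm_left.tendsto_div_nhds_zero
    refine h'.congr fun n => ?_
    simp [D, div_eq_mul_inv, mul_comm]
  have hexp (c : ℝ) (hc : 0 ≤ c) (X : 𝔸) : ‖NormedSpace.exp (c • X)‖ ≤ Real.exp (c * ‖X‖) := by
    refine (norm_exp_le_exp_norm _).trans ?_
    rw [norm_smul, Real.norm_of_nonneg hc]
  rw [tendsto_iff_norm_sub_tendsto_zero]
  refine squeeze_zero' (Eventually.of_forall fun _ => norm_nonneg _) ?_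
    (by simpa using hlim.const_mul (Real.exp (‖A‖ + ‖B‖)))
  filter_upwards [eventually_gt_atTop 0] with n hn
  have hn' : (0 : ℝ) < n := by exact_mod_cast hn
  -- `C ^ n` does not depend on `n`, so telescoping the powers costs only a constant times `n * ‖D
  -- (1 / n)‖`, which tends to zero.
  set C : ℝ := Real.exp ((n : ℝ)⁻¹ * (‖A‖ + ‖B‖))
  have hC1 : 1 ≤ C := Real.one_le_exp (by positivity)
  have h1 : ‖NormedSpace.exp ((n : ℝ)⁻¹ • A) * NormedSpace.exp ((n : ℝ)⁻¹ • B)‖ ≤ C := by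
    refine (norm_mul_le _ _).trans ((mul_le_mul (hexp _ (by positivity) _)
      (hexp _ (by positivity) _) (norm_nonneg _) (Real.exp_pos _).le).trans (le_of_eq ?_))
    rw [← Real.exp_add, ← mul_add]
  have h2 : ‖NormedSpace.exp ((n : ℝ)⁻¹ • (A + B))‖ ≤ C :=
    (hexp _ (by positivity) _).trans (Real.exp_le_exp.2 (by gcongr; exact norm_add_le _ _))
  have h3 : NormedSpace.exp (A + B) = NormedSpace.exp ((n : ℝ)⁻¹ • (A + B)) ^ n := by
    let _ : NormedAlgebra ℚ 𝔸 := NormedAlgebra.restrictScalars ℚ ℝ 𝔸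
    rw [← NormedSpace.exp_nsmul, ← Nat.cast_smul_eq_nsmul ℝ, smul_smul,
      mul_inv_cancel₀ hn'.ne', one_smul]
  have h4 : C ^ (n - 1) ≤ Real.exp (‖A‖ + ‖B‖) := by
    calc C ^ (n - 1) ≤ C ^ n := pow_le_pow_right₀ hC1 (by omega)
      _ = _ := by rw [← Real.exp_nat_mul, ← mul_assoc, mul_inv_cancel₀ hn'.ne', one_mul]
  rw [h3]
  calc _ ≤ n * C ^ (n - 1) * ‖D (n : ℝ)⁻¹‖ := norm_pow_sub_pow_le h1 h2 n
    _ ≤ n * Real.exp (‖A‖ + ‖B‖) * ‖D (n : ℝ)⁻¹‖ := by gcongr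
    _ = _ := by ring

end LieTrotter

/-! ### Golden–Thompson inequality -/

section GoldenThompson

variable {ι : Type*} [Fintype ι] [DecidableEq ι]

/-- The Golden–Thompson inequality. -/
lemma trace_exp_add_le {A B : Matrix ι ι ℝ} (hA : A.IsHermitian) (hB : B.IsHermitian) :
    (NormedSpace.exp (A + B)).trace ≤ (NormedSpace.exp A * NormedSpace.exp B).trace := by
  cases isEmpty_or_nonempty ι
  · simp [Matrix.trace]
  -- The subsequence `n = 2 ^ k` suffices, and the trace inequality covers exactly these exponents.
  have hlim := (((continuous_id.matrix_trace).tendsto _).comp (tendsto_exp_mul_exp_pow A B)).comp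
    (tendsto_pow_atTop_atTop_of_one_lt (one_lt_two : (1 : ℕ) < 2))
  refine le_of_tendsto' hlim fun k => ?_
  have hr (X : Matrix ι ι ℝ) :
      NormedSpace.exp X = NormedSpace.exp (((2 ^ k : ℕ) : ℝ)⁻¹ • X) ^ 2 ^ k := by
    rw [← Matrix.exp_nsmul, ← Nat.cast_smul_eq_nsmul ℝ, smul_smul,
      mul_inv_cancel₀ (by positivity), one_smul]
  have hh {X : Matrix ι ι ℝ} (hX : X.IsHermitian) (c : ℝ) :
      (NormedSpace.exp (c • X)).IsHermitian :=
    Matrix.IsHermitian.exp (by rw [Matrix.IsHermitian, Matrix.conjTranspose_smul, hX.eq]; simp)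
  rw [hr A, hr B]
  exact trace_mul_pow_two_pow_le k (hh hA _) (hh hB _)

end GoldenThompson

/-! ### Matrix Hoeffding inequality in counting form -/

section MatrixHoeffding

variable {ι : Type*} [Fintype ι] [DecidableEq ι]

lemma exists_diagonalization {A : Matrix ι ι ℝ} (hA : A.IsHermitian) :
    ∃ (U : Matrix.unitaryGroup ι ℝ) (v : ι → ℝ),
      A = U.1 * Matrix.diagonal v * star U.1 ∧
      NormedSpace.exp A = U.1 * Matrix.diagonal (fun i => Real.exp (v i)) * star U.1 ∧
      ‖A‖ = ‖v‖ := by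
  have h : A = (hA.eigenvectorUnitary).1 * Matrix.diagonal hA.eigenvalues *
      star (hA.eigenvectorUnitary).1 := by
    simpa [Function.comp_def, Unitary.conjStarAlgAut_apply] using hA.spectral_theorem
  refine ⟨hA.eigenvectorUnitary, hA.eigenvalues, h, ?_, ?_⟩
  · have hinv : star (hA.eigenvectorUnitary).1 = (hA.eigenvectorUnitary).1⁻¹ :=
      (Matrix.inv_eq_right_inv (Unitary.mul_star_self_of_mem hA.eigenvectorUnitary.2)).symm
    conv_lhs => rw [h, hinv, Matrix.exp_conj _ _ (Unitary.isUnit_coe), Matrix.exp_diagonal]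
    rw [hinv, Pi.exp_def]
    simp only [Real.exp_eq_exp_ℝ]
  · conv_lhs => rw [h]
    rw [CStarRing.norm_mul_mem_unitary _ (Unitary.star_mem hA.eigenvectorUnitary.2),
      CStarRing.norm_mem_unitary_mul _ hA.eigenvectorUnitary.2, Matrix.l2_opNorm_diagonal]

lemma trace_unitary_conj (U : Matrix.unitaryGroup ι ℝ) (B : Matrix ι ι ℝ) :
    (U.1 * B * star U.1).trace = B.trace := by
  rw [Matrix.trace_mul_comm, ← mul_assoc, Unitary.star_mul_self_of_mem U.2, one_mul]

lemma trace_mul_nonneg {A B : Matrix ι ι ℝ} (hA : A.PosSemidef) (hB : B.PosSemidef) :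
    0 ≤ (A * B).trace := by
  obtain ⟨C, rfl⟩ : ∃ C, A = Cᴴ * C := by
    open scoped MatrixOrder in
    exact CStarAlgebra.nonneg_iff_eq_star_mul_self.1 hA.nonneg
  rw [mul_assoc, Matrix.trace_mul_comm]
  exact (hB.mul_mul_conjTranspose_same C).trace_nonneg

lemma posSemidef_exp {A : Matrix ι ι ℝ} (hA : A.IsHermitian) : (NormedSpace.exp A).PosSemidef := by
  obtain ⟨U, v, -, h, -⟩ := exists_diagonalization hA
  rw [h]
  exact (Matrix.PosSemidef.diagonal fun i => (Real.exp_pos _).le).mul_mul_conjTranspose_same U.1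

/-- The norm is `|v i|` for some eigenvalue `v i` of unknown sign; allowing for both signs produces
the factor 2 in the tail bound. -/
lemma exp_norm_le_trace_exp_add [Nonempty ι] {A : Matrix ι ι ℝ} (hA : A.IsHermitian) :
    Real.exp ‖A‖ ≤ (NormedSpace.exp A).trace + (NormedSpace.exp (-A)).trace := by
  obtain ⟨U, v, h1, h2, h3⟩ := exists_diagonalization hA
  have h4 : NormedSpace.exp (-A) = U.1 * Matrix.diagonal (fun i => Real.exp (-v i)) * star U.1 := by
    have hinv : star U.1 = U.1⁻¹ :=
      (Matrix.inv_eq_right_inv (Unitary.mul_star_self_of_mem U.2)).symm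
    have : -A = U.1 * Matrix.diagonal (-v) * U.1⁻¹ := by
      have e : Matrix.diagonal (-v) = -Matrix.diagonal v := (Matrix.diagonal_neg v).symm
      rw [h1, hinv, e, mul_neg, neg_mul]
    rw [this, Matrix.exp_conj _ _ (Unitary.isUnit_coe), Matrix.exp_diagonal, hinv, Pi.exp_def]
    simp only [Real.exp_eq_exp_ℝ, Pi.neg_apply]
  obtain ⟨i, hi⟩ : ∃ i, ‖v‖ = ‖v i‖ := by
    obtain ⟨i, -, hi⟩ := Finset.exists_mem_eq_sup' Finset.univ_nonempty (fun i => ‖v i‖₊)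
    refine ⟨i, ?_⟩
    rw [Pi.norm_def, ← Finset.sup'_eq_sup Finset.univ_nonempty, hi]; rfl
  rw [h2, h4, trace_unitary_conj, trace_unitary_conj, h3, hi, Matrix.trace_diagonal,
    Matrix.trace_diagonal]
  have hp := Finset.single_le_sum (fun j _ => (Real.exp_pos (v j)).le) (Finset.mem_univ i)
  have hm := Finset.single_le_sum (fun j _ => (Real.exp_pos (-v j)).le) (Finset.mem_univ i)
  rw [Real.norm_eq_abs]
  exact (Real.exp_abs_le _).trans (add_le_add hp hm)

/-- By convexity, `exp` lies below its chord over `[-K, K]`. -/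
lemma exp_le_cosh_add {K u : ℝ} (hK : 0 < K) (hu : |u| ≤ K) :
    Real.exp u ≤ Real.cosh K + Real.sinh K / K * u := by
  obtain ⟨h1, h2⟩ := abs_le.1 hu
  have h := convexOn_exp.2 (Set.mem_univ K) (Set.mem_univ (-K))
    (show 0 ≤ (K + u) / (2 * K) from div_nonneg (by linarith) (by linarith))
    (show 0 ≤ (K - u) / (2 * K) from div_nonneg (by linarith) (by linarith))
    (by field_simp; ring)
  have e : (K + u) / (2 * K) * K + (K - u) / (2 * K) * (-K) = u := by field_simp; ring
  simp only [smul_eq_mul, e] at h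
  refine h.trans (le_of_eq ?_)
  rw [Real.cosh_eq, Real.sinh_eq]; field_simp; ring

/-- The chord bound on eigenvalues is an inequality of matrices, and pairing it with `P` under the
trace preserves it. -/
lemma trace_mul_exp_le {P Y : Matrix ι ι ℝ} (hP : P.PosSemidef) (hY : Y.IsHermitian) {K : ℝ}
    (hK : 0 < K) (hYK : ‖Y‖ ≤ K) :
    (P * NormedSpace.exp Y).trace ≤ Real.cosh K * P.trace + Real.sinh K / K * (P * Y).trace := by
  obtain ⟨U, v, h1, h2, h3⟩ := exists_diagonalization hY
  have hv (i : ι) : |v i| ≤ K := (norm_le_pi_norm v i).trans (h3 ▸ hYK)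
  have hpsd : (Real.cosh K • (1 : Matrix ι ι ℝ) + (Real.sinh K / K) • Y
      - NormedSpace.exp Y).PosSemidef := by
    have hd : Real.cosh K • (1 : Matrix ι ι ℝ) + (Real.sinh K / K) • Y - NormedSpace.exp Y
        = U.1 * Matrix.diagonal
          (fun i => Real.cosh K + Real.sinh K / K * v i - Real.exp (v i)) * star U.1 := by
      have e : Matrix.diagonal (fun i => Real.cosh K + Real.sinh K / K * v i - Real.exp (v i))
          = Real.cosh K • (1 : Matrix ι ι ℝ) + (Real.sinh K / K) • Matrix.diagonal v
            - Matrix.diagonal (fun i => Real.exp (v i)) := by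
        rw [← Matrix.diagonal_one, ← Matrix.diagonal_smul, ← Matrix.diagonal_smul,
          Matrix.diagonal_add, Matrix.diagonal_sub]
        simp
      rw [e, h2]
      conv_lhs => rw [h1]
      simp only [mul_sub, sub_mul, mul_add, add_mul, Matrix.mul_smul, Matrix.smul_mul, mul_one,
        Unitary.mul_star_self_of_mem U.2]
    rw [hd]
    exact (Matrix.PosSemidef.diagonal fun i =>
      sub_nonneg.2 (exp_le_cosh_add hK (hv i))).mul_mul_conjTranspose_same U.1
  have h := trace_mul_nonneg hP hpsd
  simp only [mul_sub, mul_add, Matrix.mul_smul, mul_one, Matrix.trace_sub, Matrix.trace_add,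
    Matrix.trace_smul, smul_eq_mul] at h
  linarith

variable {α : Type*} [Fintype α]

/-- Golden–Thompson separates `Y a` from `A`; the linear term of the chord then cancels in the sum
because the family is centered. -/
lemma sum_trace_exp_add_le {Y : α → Matrix ι ι ℝ} (hY : ∀ a, (Y a).IsHermitian)
    (hsum : ∑ a, Y a = 0) {K : ℝ} (hK : 0 < K) (hYK : ∀ a, ‖Y a‖ ≤ K) {A : Matrix ι ι ℝ}
    (hA : A.IsHermitian) :
    ∑ a, (NormedSpace.exp (A + Y a)).trace
      ≤ Fintype.card α * Real.cosh K * (NormedSpace.exp A).trace := by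
  calc ∑ a, (NormedSpace.exp (A + Y a)).trace
      ≤ ∑ a, (Real.cosh K * (NormedSpace.exp A).trace
          + Real.sinh K / K * (NormedSpace.exp A * Y a).trace) :=
        Finset.sum_le_sum fun a _ => (trace_exp_add_le hA (hY a)).trans
          (trace_mul_exp_le (posSemidef_exp hA) (hY a) hK (hYK a))
    _ = _ := by
        have h : ∑ a, (NormedSpace.exp A * Y a).trace = 0 := by
          rw [← Matrix.trace_sum, ← Finset.mul_sum, hsum, mul_zero, Matrix.trace_zero]
        rw [Finset.sum_add_distrib, ← Finset.mul_sum Finset.univ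
          (fun a => (NormedSpace.exp A * Y a).trace), h]
        simp [mul_assoc]

omit [Fintype ι] [DecidableEq ι] in
lemma isHermitian_sum {κ : Type*} (t : Finset κ) {Y : κ → Matrix ι ι ℝ}
    (hY : ∀ a, (Y a).IsHermitian) : (∑ a ∈ t, Y a).IsHermitian := by
  rw [Matrix.IsHermitian, Matrix.conjTranspose_sum]
  exact Finset.sum_congr rfl fun a _ => hY a

lemma sum_trace_exp_sum_le {Y : α → Matrix ι ι ℝ} (hY : ∀ a, (Y a).IsHermitian)
    (hsum : ∑ a, Y a = 0) {K : ℝ} (hK : 0 < K) (hYK : ∀ a, ‖Y a‖ ≤ K) (n : ℕ) :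
    ∑ l : Fin n → α, (NormedSpace.exp (∑ j, Y (l j))).trace
      ≤ (Fintype.card α * Real.cosh K) ^ n * Fintype.card ι := by
  induction n with
  | zero => simp
  | succ n ih =>
    have hcosh := (Real.cosh_pos K).le
    rw [← (Fin.consEquiv fun _ => α).sum_comp, Fintype.sum_prod_type_right]
    simp only [Fin.consEquiv_apply, Fin.sum_univ_succ, Fin.cons_zero, Fin.cons_succ]
    calc _ ≤ ∑ l : Fin n → α, Fintype.card α * Real.cosh K
          * (NormedSpace.exp (∑ j, Y (l j))).trace := by
          refine Finset.sum_le_sum fun l _ => ?_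
          simp only [add_comm (Y _)]
          exact sum_trace_exp_add_le hY hsum hK hYK (isHermitian_sum _ fun j => hY (l j))
      _ ≤ _ := by
          rw [← Finset.mul_sum, pow_succ', mul_assoc (_ * _)]
          exact mul_le_mul_of_nonneg_left ih (by positivity)

open Classical in
/-- Hoeffding's inequality for sums of uniform samples, drawn with replacement, from a centered
family of Hermitian matrices, in counting form. -/
lemma card_norm_sum_gt_le {Y : α → Matrix ι ι ℝ} (hY : ∀ a, (Y a).IsHermitian)
    (hsum : ∑ a, Y a = 0) {K : ℝ} (hK : 0 < K) (hYK : ∀ a, ‖Y a‖ ≤ K) {n : ℕ} (hn : 0 < n)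
    {τ : ℝ} (hτ : 0 < τ) :
    ((Finset.univ.filter fun l : Fin n → α => τ < ‖∑ j, Y (l j)‖).card : ℝ)
      ≤ 2 * Fintype.card ι * Real.exp (-(τ ^ 2 / (2 * n * K ^ 2))) * (Fintype.card α : ℝ) ^ n := by
  cases isEmpty_or_nonempty ι
  · have h0 (B : Matrix ι ι ℝ) : ‖B‖ = 0 := by rw [Subsingleton.elim B 0, norm_zero]
    simp [h0, hτ.le.not_gt]
  have hn' : (0 : ℝ) < n := by exact_mod_cast hn
  -- The minimizer of `n * (θ * K) ^ 2 / 2 - θ * τ`.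
  set θ : ℝ := τ / (n * K ^ 2) with hθ
  have hθ0 : 0 < θ := by positivity
  have hb (c : ℝ) (hc : |c| = θ) :
      ∑ l : Fin n → α, (NormedSpace.exp (∑ j, c • Y (l j))).trace
        ≤ (Fintype.card α * Real.cosh (θ * K)) ^ n * Fintype.card ι := by
    refine sum_trace_exp_sum_le (Y := fun a => c • Y a) (fun a => ?_) ?_ (by positivity)
      (fun a => ?_) n
    · rw [Matrix.IsHermitian, Matrix.conjTranspose_smul, hY a]; simp
    · rw [← Finset.smul_sum, hsum, smul_zero]
    · rw [norm_smul, Real.norm_eq_abs, hc]; gcongr; exact hYK a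
  have h1 := hb θ (abs_of_pos hθ0)
  have h2 := hb (-θ) (by rw [abs_neg, abs_of_pos hθ0])
  set s := Finset.univ.filter fun l : Fin n → α => τ < ‖∑ j, Y (l j)‖
  -- Markov's inequality for counting: each tuple in `s` contributes at least `exp (θ * τ)`, and the
  -- other terms are nonnegative.
  have hlow : (s.card : ℝ) * Real.exp (θ * τ)
      ≤ ∑ l : Fin n → α, ((NormedSpace.exp (∑ j, θ • Y (l j))).trace
        + (NormedSpace.exp (∑ j, (-θ) • Y (l j))).trace) := by
    have hH (l : Fin n → α) (c : ℝ) : (∑ j, c • Y (l j)).IsHermitian := by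
      refine isHermitian_sum (Y := fun j => c • Y (l j)) _ fun j => ?_
      rw [Matrix.IsHermitian, Matrix.conjTranspose_smul, hY]; simp
    rw [← nsmul_eq_mul]
    refine (Finset.card_nsmul_le_sum s _ _ fun l hl => ?_).trans
      (Finset.sum_le_univ_sum_of_nonneg fun l =>
        add_nonneg (posSemidef_exp (hH l _)).trace_nonneg (posSemidef_exp (hH l _)).trace_nonneg)
    have h := exp_norm_le_trace_exp_add (hH l θ)
    simp only [neg_smul, Finset.sum_neg_distrib]
    refine le_trans (Real.exp_le_exp.2 ?_) h
    rw [← Finset.smul_sum, norm_smul, Real.norm_of_nonneg hθ0.le]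
    gcongr
    exact (Finset.mem_filter.1 hl).2.le
  rw [Finset.sum_add_distrib] at hlow
  have hcosh : Real.cosh (θ * K) ^ n ≤ Real.exp (n * ((θ * K) ^ 2 / 2)) := by
    rw [Real.exp_nat_mul]
    exact pow_le_pow_left₀ (Real.cosh_pos _).le (Real.cosh_le_exp_half_sq _) n
  have hup : (s.card : ℝ) * Real.exp (θ * τ)
      ≤ 2 * Fintype.card ι * Real.exp (n * ((θ * K) ^ 2 / 2)) * (Fintype.card α : ℝ) ^ n := by
    rw [mul_pow] at h1 h2
    calc _ ≤ 2 * Fintype.card ι * Real.cosh (θ * K) ^ n * (Fintype.card α : ℝ) ^ n := by linarith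
      _ ≤ _ := by gcongr
  have he : -(τ ^ 2 / (2 * n * K ^ 2)) = n * ((θ * K) ^ 2 / 2) - θ * τ := by
    rw [hθ]; field_simp; ring
  rw [he, Real.exp_sub, mul_div_assoc', div_mul_eq_mul_div, le_div_iff₀ (Real.exp_pos _)]
  exact hup

end MatrixHoeffding

/-! ### Tail bounds for operators and vectors, and the sample size -/

section OperatorsAndVectors

variable {α : Type*} [Fintype α] {d : ℕ}

open Classical in
lemma card_norm_sum_clm_gt_le {T : α → Vec d →L[ℝ] Vec d} (hT : ∀ a, IsSelfAdjoint (T a))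
    (hsum : ∑ a, T a = 0) {K : ℝ} (hK : 0 < K) (hTK : ∀ a, ‖T a‖ ≤ K) {n : ℕ} (hn : 0 < n)
    {τ : ℝ} (hτ : 0 < τ) :
    ((Finset.univ.filter fun l : Fin n → α => τ < ‖∑ j, T (l j)‖).card : ℝ)
      ≤ 2 * d * Real.exp (-(τ ^ 2 / (2 * n * K ^ 2))) * (Fintype.card α : ℝ) ^ n := by
  let e := (Matrix.toEuclideanCLM (n := Fin d) (𝕜 := ℝ)).symm
  have he (B : Vec d →L[ℝ] Vec d) : ‖e B‖ = ‖B‖ := by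
    rw [← Matrix.l2_opNorm_toEuclideanCLM]; simp [e]
  have h := card_norm_sum_gt_le (Y := fun a => e (T a))
    (fun a => (e.map_star' (T a)).symm.trans (congrArg e (hT a)))
    (by rw [← map_sum, hsum, map_zero]) hK (fun a => (he _).trans_le (hTK a)) hn hτ
  simpa only [← map_sum, he, Fintype.card_fin] using h

/-- The Hermitian dilation of a vector, regarded as a matrix with one column. -/
def dilation : Vec d →ₗ[ℝ] Matrix (Fin d ⊕ Unit) (Fin d ⊕ Unit) ℝ where
  toFun v := Matrix.fromBlocks 0 (Matrix.of fun i _ => v i) (Matrix.of fun _ i => v i) 0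
  map_add' v w := by ext (i | i) (j | j) <;> simp
  map_smul' c v := by ext (i | i) (j | j) <;> simp

lemma isHermitian_dilation (v : Vec d) : (dilation v).IsHermitian := by
  ext (i | i) (j | j) <;> simp [dilation]

/-- The dilation sends `(x, c)` to `(c • v, ⟪v, x⟫)`: Cauchy–Schwarz gives the upper bound, the last
basis vector the lower one. -/
lemma norm_dilation (v : Vec d) : ‖dilation v‖ = ‖v‖ := by
  rw [← Matrix.l2_opNorm_toEuclideanCLM]
  refine le_antisymm (ContinuousLinearMap.opNorm_le_bound _ (norm_nonneg v) fun x => ?_) ?_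
  · refine le_of_sq_le_sq ?_ (by positivity)
    have hcs := Finset.sum_mul_sq_le_sq_mul_sq Finset.univ (fun i => v i) (fun i => x (Sum.inl i))
    rw [mul_pow, EuclideanSpace.norm_sq_eq, EuclideanSpace.norm_sq_eq, EuclideanSpace.norm_sq_eq]
    simp only [Matrix.ofLp_toEuclideanCLM, Fintype.sum_sum_type, Real.norm_eq_abs, sq_abs]
    simp [dilation, Matrix.mulVec, dotProduct, mul_pow, ← Finset.sum_mul] at hcs ⊢
    linarith
  · have h := (Matrix.toEuclideanCLM (n := Fin d ⊕ Unit) (𝕜 := ℝ) (dilation v)).le_opNorm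
      (EuclideanSpace.single (Sum.inr ()) 1)
    rw [PiLp.norm_single, norm_one, mul_one] at h
    refine le_trans (le_of_eq ?_) h
    rw [EuclideanSpace.norm_eq, EuclideanSpace.norm_eq]
    simp only [Matrix.ofLp_toEuclideanCLM, Fintype.sum_sum_type]
    simp [dilation, Matrix.mulVec, dotProduct]

open Classical in
lemma card_norm_sum_vec_gt_le {Y : α → Vec d} (hsum : ∑ a, Y a = 0) {K : ℝ} (hK : 0 < K)
    (hYK : ∀ a, ‖Y a‖ ≤ K) {n : ℕ} (hn : 0 < n) {τ : ℝ} (hτ : 0 < τ) :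
    ((Finset.univ.filter fun l : Fin n → α => τ < ‖∑ j, Y (l j)‖).card : ℝ)
      ≤ 2 * (d + 1) * Real.exp (-(τ ^ 2 / (2 * n * K ^ 2))) * (Fintype.card α : ℝ) ^ n := by
  have h := card_norm_sum_gt_le (Y := fun a => dilation (Y a)) (fun a => isHermitian_dilation _)
    (by rw [← map_sum, hsum, map_zero]) hK (fun a => (norm_dilation _).trans_le (hYK a)) hn hτ
  simpa [← map_sum, norm_dilation] using h

variable {E : Type*} [NormedAddCommGroup E] [NormedSpace ℝ E]

lemma sum_sub_mean [Nonempty α] (X : α → E) :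
    ∑ a, (X a - (1 / (Fintype.card α : ℝ)) • ∑ b, X b) = 0 := by
  rw [Finset.sum_sub_distrib, Finset.sum_const, Finset.card_univ, ← Nat.cast_smul_eq_nsmul ℝ,
    smul_smul, mul_one_div_cancel (by simp), one_smul, sub_self]

lemma norm_sub_mean_le [Nonempty α] {X : α → E} {R : ℝ} (hX : ∀ a, ‖X a‖ ≤ R) (a : α) :
    ‖X a - (1 / (Fintype.card α : ℝ)) • ∑ b, X b‖ ≤ 2 * R := by
  have hc : (0 : ℝ) < Fintype.card α := by exact_mod_cast Fintype.card_pos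
  have h : ‖(1 / (Fintype.card α : ℝ)) • ∑ b, X b‖ ≤ R := by
    rw [norm_smul, Real.norm_of_nonneg (by positivity), one_div, inv_mul_le_iff₀ hc]
    exact (norm_sum_le_of_le _ fun b _ => hX b).trans (by simp)
  linarith [norm_sub_le (X a) ((1 / (Fintype.card α : ℝ)) • ∑ b, X b), hX a]

open Classical in
/-- A Hoeffding bound for the sums of centered samples yields the sample size that makes the
sample mean `t`-accurate with probability at least `1 - ζ`. -/
lemma card_mean_deviation_le [Nonempty α] {X : α → E} {R t D c ζ : ℝ} {n : ℕ}
    (hX : ∀ a, ‖X a‖ ≤ R) (ht : 0 < t) (hDc : 2 * D ≤ c) (hζ : 0 < ζ) (hζ1 : ζ < 1)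
    (hc : 1 ≤ c)
    (hoeffding : ∀ K : ℝ, 0 < K → (∀ a, ‖X a - (1 / (Fintype.card α : ℝ)) • ∑ b, X b‖ ≤ K) →
      0 < n → ∀ τ : ℝ, 0 < τ →
      ((Finset.univ.filter fun l : Fin n → α =>
          τ < ‖∑ j, (X (l j) - (1 / (Fintype.card α : ℝ)) • ∑ b, X b)‖).card : ℝ)
        ≤ 2 * D * Real.exp (-(τ ^ 2 / (2 * n * K ^ 2))) * (Fintype.card α : ℝ) ^ n)
    (hsize : (8 * R ^ 2 / t ^ 2 + 4 * R / (3 * t)) * Real.log (c / ζ) ≤ n) :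
    ((Finset.univ.filter fun l : Fin n → α =>
        t < ‖(1 / (n : ℝ)) • ∑ j, X (l j) - (1 / (Fintype.card α : ℝ)) • ∑ b, X b‖).card : ℝ)
      ≤ ζ * (Fintype.card α : ℝ) ^ n := by
  have hR : 0 ≤ R := (norm_nonneg _).trans (hX (Classical.arbitrary α))
  -- For `R = 0` the size condition allows `n = 0`, but all samples vanish.
  rcases hR.eq_or_lt with rfl | hR
  · have h0 (a : α) : X a = 0 := norm_le_zero_iff.1 (hX a)
    have : ¬ t < 0 := ht.not_gt
    simp [h0, this]
    positivity
  have hlog : 0 < Real.log (c / ζ) := Real.log_pos ((one_lt_div hζ).2 (hζ1.trans_le hc))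
  have hn' : (0 : ℝ) < n := lt_of_lt_of_le (by positivity) hsize
  have hn : 0 < n := by exact_mod_cast hn'
  -- With `K = 2 * R` and `τ = n * t` the exponent is `-n * t ^ 2 / (8 * R ^ 2)`, the source of the
  -- constant 8.
  have hbound := hoeffding (2 * R) (by positivity) (norm_sub_mean_le hX) hn (n * t) (by positivity)
  have hset : (Finset.univ.filter fun l : Fin n → α =>
      t < ‖(1 / (n : ℝ)) • ∑ j, X (l j) - (1 / (Fintype.card α : ℝ)) • ∑ b, X b‖)
      = Finset.univ.filter fun l : Fin n → α =>
          n * t < ‖∑ j, (X (l j) - (1 / (Fintype.card α : ℝ)) • ∑ b, X b)‖ := by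
    refine Finset.filter_congr fun l _ => ?_
    have e : ∑ j, (X (l j) - (1 / (Fintype.card α : ℝ)) • ∑ b, X b)
        = (n : ℝ) • ((1 / (n : ℝ)) • ∑ j, X (l j) - (1 / (Fintype.card α : ℝ)) • ∑ b, X b) := by
      rw [Finset.sum_sub_distrib, Finset.sum_const, Finset.card_univ, Fintype.card_fin, smul_sub,
        smul_smul, mul_one_div_cancel hn'.ne', one_smul, Nat.cast_smul_eq_nsmul]
    rw [e, norm_smul, Real.norm_of_nonneg hn'.le, mul_lt_mul_iff_right₀ hn']
  rw [hset]
  refine hbound.trans ?_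
  gcongr
  have hexp : Real.exp (-((n * t) ^ 2 / (2 * n * (2 * R) ^ 2))) ≤ ζ / c := by
    rw [← Real.exp_log (show 0 < ζ / c by positivity), ← inv_div c ζ, Real.log_inv]
    refine Real.exp_le_exp.2 (neg_le_neg ?_)
    -- The Hoeffding exponent needs only the quadratic summand; the linear, Bernstein-type one is
    -- nonnegative slack.
    have h1 : 8 * R ^ 2 / t ^ 2 * Real.log (c / ζ) ≤ n := by
      refine le_trans ?_ hsize
      gcongr
      exact le_add_of_nonneg_right (by positivity)
    rw [div_mul_eq_mul_div, div_le_iff₀ (by positivity)] at h1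
    rw [le_div_iff₀ (by positivity)]
    nlinarith
  calc 2 * D * _ ≤ c * (ζ / c) := by gcongr
    _ = ζ := by field_simp

end OperatorsAndVectors

/-! ### Gradients and Hessians of the components and the objective -/

section Derivatives

variable {d N : ℕ}

/-- Symmetry of second derivatives, which lets the Hermitian bound apply to Hessians without a
dilation. -/
lemma isSelfAdjoint_hessian {φ : Vec d → ℝ} (hφ : Differentiable ℝ φ)
    (hφ' : Differentiable ℝ (∇ φ)) (x : Vec d) : IsSelfAdjoint (hessian φ x) := by
  rw [ContinuousLinearMap.isSelfAdjoint_iff_isSymmetric]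
  intro v w
  have h1 (y : Vec d) : HasFDerivAt φ (innerSL ℝ (∇ φ y)) y :=
    (hφ y).hasGradientAt.hasFDerivAt
  have h2 : HasFDerivAt (fun y => innerSL ℝ (∇ φ y)) ((innerSL ℝ).comp (hessian φ x)) x :=
    (innerSL ℝ : Vec d →L[ℝ] _).hasFDerivAt.comp x (hφ' x).hasFDerivAt
  have h := second_derivative_symmetric h1 h2 v w
  simp only [ContinuousLinearMap.comp_apply, innerSL_apply_apply] at h
  rw [ContinuousLinearMap.coe_coe, h, real_inner_comm]

lemma gradient_objective {f : Fin N → Vec d → ℝ} (hf : ∀ i, Differentiable ℝ (f i)) (x : Vec d) :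
    ∇ (objective f) x = (1 / (N : ℝ)) • ∑ i, ∇ (f i) x := by
  have h : HasFDerivAt (objective f) ((1 / (N : ℝ)) • ∑ i, fderiv ℝ (f i) x) x :=
    (HasFDerivAt.fun_sum fun i _ => (hf i x).hasFDerivAt).const_mul _
  simp only [gradient, h.fderiv, map_smulₛₗ, map_sum]
  simp

lemma hessian_objective {f : Fin N → Vec d → ℝ} (hf : ∀ i, Differentiable ℝ (f i))
    (hf' : ∀ i, Differentiable ℝ (∇ (f i))) (x : Vec d) :
    hessian (objective f) x = (1 / (N : ℝ)) • ∑ i, hessian (f i) x := by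
  have h : HasFDerivAt (∇ (objective f)) ((1 / (N : ℝ)) • ∑ i, fderiv ℝ (∇ (f i)) x) x := by
    rw [funext (gradient_objective hf)]
    exact (HasFDerivAt.fun_sum fun i _ => (hf' i x).hasFDerivAt).const_smul (1 / (N : ℝ))
  exact h.fderiv

end Derivatives

/-! ### Counting inaccurate mini-batches -/

section MiniBatches

variable {d N : ℕ} {f : Fin N → Vec d → ℝ} {L₀ L₁ L₂ : ℝ≥0}

/-- This exhibits the error as sample mean minus population mean of the gradient differences, whose
size is governed by `‖x - y‖`. -/
lemma vrGradient_ofFn_sub (hf : ObjectiveAssumption f L₀ L₁ L₂) (x y : Vec d) {n : ℕ}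
    (l : Fin n → Fin N) :
    vrGradient f x y (List.ofFn l) - ∇ (objective f) x
      = (1 / (n : ℝ)) • ∑ j, (∇ (f (l j)) x - ∇ (f (l j)) y)
        - (1 / (N : ℝ)) • ∑ i, (∇ (f i) x - ∇ (f i) y) := by
  rw [vrGradient, gradient_objective hf.differentiable, gradient_objective hf.differentiable,
    List.length_ofFn, List.map_ofFn, List.sum_ofFn, Finset.sum_sub_distrib (s := Finset.univ)
      (fun i => ∇ (f i) x), smul_sub (1 / (N : ℝ))]
  simp only [Function.comp_apply]
  abel

lemma vrHessian_ofFn_sub (hf : ObjectiveAssumption f L₀ L₁ L₂) (x y : Vec d) {n : ℕ}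
    (l : Fin n → Fin N) :
    vrHessian f x y (List.ofFn l) - hessian (objective f) x
      = (1 / (n : ℝ)) • ∑ j, (hessian (f (l j)) x - hessian (f (l j)) y)
        - (1 / (N : ℝ)) • ∑ i, (hessian (f i) x - hessian (f i) y) := by
  rw [vrHessian, hessian_objective hf.differentiable hf.differentiable_gradient,
    hessian_objective hf.differentiable hf.differentiable_gradient,
    List.length_ofFn, List.map_ofFn, List.sum_ofFn, Finset.sum_sub_distrib (s := Finset.univ)
      (fun i => hessian (f i) x), smul_sub (1 / (N : ℝ))]
  simp only [Function.comp_apply]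
  abel

open Classical in
/-- Among the mini-batches of a sufficiently large size, at most a fraction `ζ` yields an
inaccurate variance-reduced gradient. -/
lemma card_inaccurate_vrGradient_le (hN : 0 < N) (hf : ObjectiveAssumption f L₀ L₁ L₂)
    (x y : Vec d) {t ζ : ℝ} (ht : 0 < t) (hζ : 0 < ζ) (hζ1 : ζ < 1) {n : ℕ}
    (hsize : (8 * (L₁ * ‖x - y‖) ^ 2 / t ^ 2 + 4 * (L₁ * ‖x - y‖) / (3 * t))
      * Real.log (2 * ((d : ℝ) + 1) / ζ) ≤ n) :
    ((Finset.univ.filter fun l : Fin n → Fin N =>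
        t < ‖vrGradient f x y (List.ofFn l) - ∇ (objective f) x‖).card : ℝ) ≤ ζ * (N : ℝ) ^ n := by
  have : Nonempty (Fin N) := ⟨⟨0, hN⟩⟩
  simp only [vrGradient_ofFn_sub hf]
  have h := card_mean_deviation_le (α := Fin N) (X := fun i => ∇ (f i) x - ∇ (f i) y)
    (R := L₁ * ‖x - y‖) (D := (d : ℝ) + 1) (fun i => (hf.lipschitz_gradient i).norm_sub_le x y)
    ht le_rfl hζ hζ1 (by linarith [(Nat.cast_nonneg d : (0 : ℝ) ≤ d)])
    (fun K hK hle hn τ hτ => card_norm_sum_vec_gt_le (sum_sub_mean _) hK hle hn hτ) hsize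
  simpa only [Fintype.card_fin] using h

open Classical in
/-- Among the mini-batches of a sufficiently large size, at most a fraction `ζ` yields an
inaccurate variance-reduced Hessian. -/
lemma card_inaccurate_vrHessian_le (hN : 0 < N) (hf : ObjectiveAssumption f L₀ L₁ L₂)
    (x y : Vec d) {t ζ : ℝ} (ht : 0 < t) (hζ : 0 < ζ) (hζ1 : ζ < 1) {n : ℕ}
    (hsize : (8 * (L₂ * ‖x - y‖) ^ 2 / t ^ 2 + 4 * (L₂ * ‖x - y‖) / (3 * t))
      * Real.log (4 * (d : ℝ) / ζ) ≤ n) :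
    ((Finset.univ.filter fun l : Fin n → Fin N =>
        t < ‖vrHessian f x y (List.ofFn l) - hessian (objective f) x‖).card : ℝ)
      ≤ ζ * (N : ℝ) ^ n := by
  have : Nonempty (Fin N) := ⟨⟨0, hN⟩⟩
  -- In dimension zero the factor `4 * d` is not at least 1, but there every operator has norm zero.
  rcases Nat.eq_zero_or_pos d with rfl | hd
  · have h0 (B : Vec 0 →L[ℝ] Vec 0) : ‖B‖ = 0 := by rw [Subsingleton.elim B 0, norm_zero]
    simp only [h0, ht.not_gt, Finset.filter_false, Finset.card_empty, Nat.cast_zero]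
    positivity
  have hd' : (1 : ℝ) ≤ d := by exact_mod_cast hd
  simp only [vrHessian_ofFn_sub hf]
  have hsa (i : Fin N) : IsSelfAdjoint (hessian (f i) x - hessian (f i) y) :=
    IsSelfAdjoint.sub (R := Vec d →L[ℝ] Vec d)
      (isSelfAdjoint_hessian (hf.differentiable i) (hf.differentiable_gradient i) x)
      (isSelfAdjoint_hessian (hf.differentiable i) (hf.differentiable_gradient i) y)
  have hsum : IsSelfAdjoint (∑ i, (hessian (f i) x - hessian (f i) y)) :=
    isSelfAdjoint_sum (R := Vec d →L[ℝ] Vec d) Finset.univ fun i _ => hsa i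
  have hmean : IsSelfAdjoint
      ((1 / (Fintype.card (Fin N) : ℝ)) • ∑ i, (hessian (f i) x - hessian (f i) y)) :=
    IsSelfAdjoint.smul (R := ℝ) (A := Vec d →L[ℝ] Vec d) (.all _) hsum
  have h := card_mean_deviation_le (α := Fin N) (X := fun i => hessian (f i) x - hessian (f i) y)
    (R := L₂ * ‖x - y‖) (D := d) (fun i => (hf.lipschitz_hessian i).norm_sub_le x y)
    ht (by linarith) hζ hζ1 (by linarith)
    (fun K hK hle hn τ hτ => card_norm_sum_clm_gt_le
      (fun a => IsSelfAdjoint.sub (R := Vec d →L[ℝ] Vec d) (hsa a) hmean)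
      (sum_sub_mean _) hK hle hn hτ) hsize
  simpa only [Fintype.card_fin] using h

lemma continuous_list_sum_map {X E κ : Type*} [TopologicalSpace X] [TopologicalSpace E]
    [AddMonoid E] [ContinuousAdd E] {g : κ → X → E} (hg : ∀ a, Continuous (g a)) (l : List κ) :
    Continuous fun x => (l.map fun a => g a x).sum := by
  induction l with
  | nil => simpa using continuous_const
  | cons a l ih => simp only [List.map_cons, List.sum_cons]; exact (hg a).add ih

lemma continuous_vrGradient_error (hf : ObjectiveAssumption f L₀ L₁ L₂) (l : List (Fin N)) :
    Continuous fun p : Vec d × Vec d =>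
      ‖vrGradient f p.1 p.2 l - ∇ (objective f) p.1‖ := by
  have hc (i : Fin N) : Continuous (∇ (f i)) := (hf.lipschitz_gradient i).continuous
  have hF : Continuous (∇ (objective f)) := by
    rw [funext (gradient_objective hf.differentiable)]; fun_prop
  have hs := continuous_list_sum_map (g := fun i (p : Vec d × Vec d) => ∇ (f i) p.1 - ∇ (f i) p.2)
    (fun i => by fun_prop) l
  unfold vrGradient
  fun_prop

lemma continuous_vrHessian_error (hf : ObjectiveAssumption f L₀ L₁ L₂) (l : List (Fin N)) :
    Continuous fun p : Vec d × Vec d =>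
      ‖vrHessian f p.1 p.2 l - hessian (objective f) p.1‖ := by
  have hc (i : Fin N) : Continuous (hessian (f i)) := (hf.lipschitz_hessian i).continuous
  have hF : Continuous (hessian (objective f)) := by
    rw [funext (hessian_objective hf.differentiable hf.differentiable_gradient)]; fun_prop
  have hs := continuous_list_sum_map
    (g := fun i (p : Vec d × Vec d) => hessian (f i) p.1 - hessian (f i) p.2)
    (fun i => by fun_prop) l
  unfold vrHessian
  fun_prop

end MiniBatches

/-! ### From counting to conditional probability -/

section Conditioning

variable {Ω : Type*} {hist : MeasurableSpace Ω} [mΩ : MeasurableSpace Ω] {μ : Measure Ω} {N : ℕ}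

open Classical in
/-- If, for each outcome in the event `A` of the history, at most a fraction `c` of the possible
batches is bad, then the drawn batch is bad on at most a fraction `c` of `A`. -/
lemma SampledWithReplacement.measure_inter_le {E : Set Ω} {ξ : Ω → List (Fin N)}
    (h : SampledWithReplacement μ hist E ξ) (hle : hist ≤ mΩ) (hN : 0 < N)
    {bad : List (Fin N) → Set Ω} (hbad : ∀ l, MeasurableSet[hist] (bad l)) {A : Set Ω}
    (hA : MeasurableSet[hist] A) (hAE : A ⊆ E) {c : ℝ≥0∞}
    (hc : ∀ ω ∈ A, ((Finset.univ.filter fun l : Fin (ξ ω).length → Fin N =>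
      ω ∈ bad (List.ofFn l)).card : ℝ≥0∞) ≤ c * (N : ℝ≥0∞) ^ (ξ ω).length) :
    μ (A ∩ {ω | ω ∈ bad (ξ ω)}) ≤ c * μ A := by
  have hAn (n : ℕ) : MeasurableSet[hist] (A ∩ {ω | (ξ ω).length = n}) :=
    hA.inter (h.size_measurable n)
  have hsize (n : ℕ) : μ ((A ∩ {ω | (ξ ω).length = n}) ∩ {ω | ω ∈ bad (ξ ω)})
      ≤ c * μ (A ∩ {ω | (ξ ω).length = n}) := by
    set B := A ∩ {ω | (ξ ω).length = n}
    have hBm : MeasurableSet B := hle _ (hAn n)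
    have hsub : B ∩ {ω | ω ∈ bad (ξ ω)}
        ⊆ ⋃ l : Fin n → Fin N, (B ∩ bad (List.ofFn l)) ∩ {ω | ξ ω = List.ofFn l} := by
      rintro ω ⟨⟨hωA, hωn⟩, hωb⟩
      obtain ⟨l, hl⟩ : ∃ l : Fin n → Fin N, ξ ω = List.ofFn l := by
        obtain rfl := hωn
        exact ⟨(ξ ω).get, (List.ofFn_get _).symm⟩
      refine Set.mem_iUnion.2 ⟨l, ⟨⟨⟨hωA, hωn⟩, ?_⟩, hl⟩⟩
      rw [← hl]; exact hωb
    -- `B ∩ bad (List.ofFn l)` is a history event, so the sampling law applies. Summing over `l`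
    -- inside the integral then counts the bad tuples at each outcome.
    have hlaw (l : Fin n → Fin N) : μ ((B ∩ bad (List.ofFn l)) ∩ {ω | ξ ω = List.ofFn l})
        = ((N : ℝ≥0∞)⁻¹) ^ n * ∫⁻ ω in B, (bad (List.ofFn l)).indicator 1 ω ∂μ := by
      rw [h.law _ _ ((hAn n).inter (hbad _)) (fun ω hω => hAE hω.1.1), List.length_ofFn,
        lintegral_indicator_one (hle _ (hbad _)), Measure.restrict_apply (hle _ (hbad _))]
      congr 2
      ext ω
      simp only [B, Set.mem_inter_iff, Set.mem_ofPred_eq]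
      tauto
    calc μ (B ∩ {ω | ω ∈ bad (ξ ω)})
        ≤ ∑ l : Fin n → Fin N, μ ((B ∩ bad (List.ofFn l)) ∩ {ω | ξ ω = List.ofFn l}) :=
          (measure_mono hsub).trans (measure_iUnion_fintype_le _ _)
      _ = ((N : ℝ≥0∞)⁻¹) ^ n
          * ∫⁻ ω in B, ∑ l : Fin n → Fin N, (bad (List.ofFn l)).indicator 1 ω ∂μ := by
          rw [lintegral_finsetSum _ fun l _ => measurable_one.indicator (hle _ (hbad _)),
            Finset.mul_sum]
          exact Finset.sum_congr rfl fun l _ => hlaw l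
      _ ≤ ((N : ℝ≥0∞)⁻¹) ^ n * ∫⁻ _ in B, c * (N : ℝ≥0∞) ^ n ∂μ := by
          refine mul_le_mul' le_rfl ?_
          refine setLIntegral_mono measurable_const fun ω hω => ?_
          have hω' := hc ω hω.1
          rw [show (ξ ω).length = n from hω.2] at hω'
          refine le_trans (le_of_eq ?_) hω'
          rw [Finset.card_filter, Nat.cast_sum]
          refine Finset.sum_congr rfl fun l _ => ?_
          by_cases hl : ω ∈ bad (List.ofFn l) <;> simp [hl]
      _ = c * μ B := by
          have hN0 : (N : ℝ≥0∞) ≠ 0 := by exact_mod_cast hN.ne'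
          rw [setLIntegral_const, mul_comm c, mul_assoc, ← mul_assoc, ← mul_pow,
            ENNReal.inv_mul_cancel hN0 (ENNReal.natCast_ne_top N), one_pow, one_mul]
  have hunion : A = ⋃ n, A ∩ {ω | (ξ ω).length = n} := by ext ω; simp
  calc μ (A ∩ {ω | ω ∈ bad (ξ ω)})
      ≤ ∑' n, μ ((A ∩ {ω | (ξ ω).length = n}) ∩ {ω | ω ∈ bad (ξ ω)}) := by
        conv_lhs => rw [hunion, Set.iUnion_inter]
        exact measure_iUnion_le _
    _ ≤ ∑' n, c * μ (A ∩ {ω | (ξ ω).length = n}) := ENNReal.tsum_le_tsum hsize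
    _ = c * μ A := by
        rw [ENNReal.tsum_mul_left]
        conv_rhs => rw [hunion]
        rw [measure_iUnion (fun i j hij => ?_) fun n => hle _ (hAn n)]
        exact Set.disjoint_left.2 fun ω hi hj => hij (hi.2.symm.trans hj.2)

variable [IsProbabilityMeasure μ]

/-- Test `h` on the part of `G` where the conditional probability is below `1 - ζ`: positive measure
there would contradict it. -/
lemma ae_le_condExp_of_measure_diff_le (hle : hist ≤ mΩ) {S G : Set Ω} (hS : MeasurableSet S)
    (hG : MeasurableSet[hist] G) {ζ : ℝ}
    (h : ∀ A, MeasurableSet[hist] A → A ⊆ G → μ.real (A \ S) ≤ ζ * μ.real A) :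
    ∀ᵐ ω ∂μ, ω ∈ G → 1 - ζ ≤ (μ⟦S|hist⟧) ω := by
  set g := μ⟦S|hist⟧
  have hgm : Measurable[hist] g := stronglyMeasurable_condExp.measurable
  set B := {ω | g ω < 1 - ζ} ∩ G
  have hB : MeasurableSet[hist] B := (measurableSet_lt hgm measurable_const).inter hG
  have hSi : Integrable (S.indicator fun _ => (1 : ℝ)) μ := (integrable_const 1).indicator hS
  have hint : ∫ ω in B, g ω ∂μ = μ.real (B ∩ S) := by
    rw [setIntegral_condExp hle hSi hB, setIntegral_indicator hS]
    simp
  have hge : (1 - ζ) * μ.real B ≤ ∫ ω in B, g ω ∂μ := by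
    rw [hint]
    linarith [h B hB Set.inter_subset_right, measureReal_inter_add_sdiff (μ := μ) (s := B) hS]
  have hgi : IntegrableOn (fun ω => 1 - ζ - g ω) B μ :=
    ((integrable_const _).sub integrable_condExp).integrableOn
  have hB0 : μ B = 0 := by
    by_contra hne
    have hpos : 0 < ∫ ω in B, (1 - ζ - g ω) ∂μ := by
      rw [setIntegral_pos_iff_support_of_nonneg_ae _ hgi]
      · refine (pos_iff_ne_zero.2 hne).trans_le (measure_mono fun ω hω => ⟨?_, hω⟩)
        exact (sub_pos.2 hω.1).ne'
      · exact (ae_restrict_iff' (hle _ hB)).2 (.of_forall fun ω hω => (sub_pos.2 hω.1).le)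
    rw [integral_sub (integrable_const _) integrable_condExp.integrableOn] at hpos
    simp at hpos
    linarith
  filter_upwards [measure_eq_zero_iff_ae_notMem.1 hB0] with ω hω hωG
  exact not_lt.1 fun hlt => hω ⟨hlt, hωG⟩

lemma one_sub_le_measureReal_of_measure_diff_le {E S : Set Ω} (hE : MeasurableSet E)
    (hS : MeasurableSet S) {ζ : ℝ} (h : μ.real (E \ S) ≤ ζ) :
    1 - ζ ≤ μ.real {ω | ω ∈ E → ω ∈ S} := by
  have e : {ω | ω ∈ E → ω ∈ S} = (E \ S)ᶜ := by ext ω; simp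
  rw [e, probReal_compl_eq_one_sub (hE.diff hS)]
  linarith

open Classical in
/-- If batches of a sufficient size fail with frequency at most `ζ`, then, given the history, the
drawn batch succeeds with conditional probability at least `1 - ζ` wherever its size suffices. -/
lemma SampledWithReplacement.accuracy {E : Set Ω} {ξ : Ω → List (Fin N)}
    (h : SampledWithReplacement μ hist E ξ) (hle : hist ≤ mΩ) (hN : 0 < N)
    (hE : MeasurableSet[hist] E) (hξ : ∀ l, MeasurableSet {ω | ξ ω = l})
    {err : List (Fin N) → Ω → ℝ} (herr : ∀ l, Measurable[hist] (err l))
    {tol size : Ω → ℝ} (htol : Measurable[hist] tol) (hsize : Measurable[hist] size)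
    {ζ : ℝ} (hζ : 0 < ζ)
    (hcount : ζ < 1 → ∀ ω, ∀ n : ℕ, size ω ≤ n →
      ((Finset.univ.filter fun l : Fin n → Fin N => tol ω < err (List.ofFn l) ω).card : ℝ)
        ≤ ζ * (N : ℝ) ^ n) :
    (∀ᵐ ω ∂μ, ω ∈ E → size ω ≤ (ξ ω).length →
        1 - ζ ≤ (μ⟦{ω | err (ξ ω) ω ≤ tol ω}|hist⟧) ω) ∧
      ((∀ᵐ ω ∂μ, ω ∈ E → size ω ≤ (ξ ω).length) →
        1 - ζ ≤ μ.real {ω | ω ∈ E → err (ξ ω) ω ≤ tol ω}) := by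
  set S := {ω | err (ξ ω) ω ≤ tol ω}
  set G := E ∩ {ω | size ω ≤ (ξ ω).length}
  have hS : MeasurableSet S := by
    have e : S = ⋃ l, {ω | ξ ω = l} ∩ {ω | err l ω ≤ tol ω} := by
      ext ω; simp [S]
    rw [e]
    exact .iUnion fun l => (hξ l).inter (hle _ (measurableSet_le (herr l) htol))
  have hlen : Measurable[hist] fun ω => ((ξ ω).length : ℝ) :=
    (measurable_from_top (f := fun n : ℕ => (n : ℝ))).comp
      (@measurable_to_countable' _ _ _ _ hist _ fun n => h.size_measurable n)
  have hG : MeasurableSet[hist] G := hE.inter (measurableSet_le hsize hlen)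
  have hmain : ∀ A, MeasurableSet[hist] A → A ⊆ G → μ.real (A \ S) ≤ ζ * μ.real A := by
    intro A hA hAG
    rcases le_or_gt 1 ζ with hζ1 | hζ1
    · exact (measureReal_mono Set.sdiff_subset).trans
        (le_mul_of_one_le_left measureReal_nonneg hζ1)
    have hm := h.measure_inter_le hle hN (bad := fun l => {ω | tol ω < err l ω})
      (fun l => measurableSet_lt htol (herr l)) hA (fun ω hω => (hAG hω).1) (c := .ofReal ζ)
      (fun ω hω => by
        have := ENNReal.ofReal_le_ofReal (hcount hζ1 ω _ (hAG hω).2)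
        rw [ENNReal.ofReal_mul hζ.le, ENNReal.ofReal_pow (Nat.cast_nonneg _),
          ENNReal.ofReal_natCast, ENNReal.ofReal_natCast] at this
        exact this)
    have e : A \ S = A ∩ {ω | ω ∈ {ω' | tol ω' < err (ξ ω) ω'}} := by
      ext ω; simp [S]
    rw [e, measureReal_def, measureReal_def]
    refine (ENNReal.toReal_mono (by finiteness) hm).trans (le_of_eq ?_)
    rw [ENNReal.toReal_mul, ENNReal.toReal_ofReal hζ.le]
  refine ⟨?_, fun hae => ?_⟩
  · filter_upwards [ae_le_condExp_of_measure_diff_le hle hS hG hmain] with ω hω h1 h2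
    exact hω ⟨h1, h2⟩
  · refine one_sub_le_measureReal_of_measure_diff_le (hle _ hE) hS ?_
    -- `E` and `G` agree up to a null set, so the bound for the history event `G` serves for `E`.
    have e : μ.real (E \ S) = μ.real (G \ S) := by
      refine measureReal_congr ?_
      filter_upwards [hae] with ω hω
      exact propext ⟨fun hx => ⟨⟨hx.1, hω hx.1⟩, hx.2⟩, fun hx => ⟨hx.1.1, hx.2⟩⟩
    rw [e]
    exact (hmain G hG subset_rfl).trans (mul_le_of_le_one_right hζ.le measureReal_le_one)

/-- A sure event has conditional and unconditional probability at least `1 - ζ`. -/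
lemma accuracy_of_eq_univ (hle : hist ≤ mΩ) {E G S : Set Ω} (hS : S = Set.univ) {ζ : ℝ}
    (hζ : 0 < ζ) :
    (∀ᵐ ω ∂μ, ω ∈ E → ω ∈ G → 1 - ζ ≤ (μ⟦S|hist⟧) ω) ∧
      ((∀ᵐ ω ∂μ, ω ∈ E → ω ∈ G) → 1 - ζ ≤ μ.real {ω | ω ∈ E → ω ∈ S}) := by
  subst hS
  refine ⟨.of_forall fun ω _ _ => ?_, fun _ => ?_⟩
  · rw [Set.indicator_univ, condExp_const hle]; linarith
  · simp [hζ.le]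

end Conditioning

/-! ### Accuracy of the estimates along a run -/

section Accuracy

variable {Ω : Type*} [mΩ : MeasurableSpace Ω] {μ : Measure Ω} {ℱ : Filtration ℕ mΩ} {d N : ℕ}
  {f : Fin N → Vec d → ℝ} {L₀ L₁ L₂ : ℝ≥0} {x₀ : Vec d} {m : ℕ} {M ε₁ : ℝ} {x s : ℕ → Ω → Vec d}
  {ξg ξH : ℕ → Ω → List (Fin N)}

lemma IsRun.measurableSet_executed (h : IsRun μ ℱ f x₀ m M ε₁ x s ξg ξH) (k : ℕ) :
    MeasurableSet[ℱ k] (executed ε₁ s k) := by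
  have hs {j : ℕ} (hj : j ≤ k) : Measurable[ℱ k] fun ω => ‖s j ω‖ :=
    measurable_norm.comp ((h.s_measurable j).mono (ℱ.mono hj) le_rfl)
  have e : executed ε₁ s k = ⋂ j, ⋂ (_ : j < k), {ω | ε₁ < max ‖s (j + 1) ω‖ ‖s j ω‖} := by
    ext ω; simp [executed]
  rw [e]
  exact .iInter fun j => .iInter fun hj =>
    measurableSet_lt measurable_const ((hs hj).max (hs hj.le))

lemma IsRun.measurable_anchor (h : IsRun μ ℱ f x₀ m M ε₁ x s ξg ξH) (k : ℕ) :
    Measurable[ℱ k] (anchor m x k) :=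
  (h.x_measurable (k / m * m)).mono (ℱ.mono (Nat.div_mul_le_self k m)) le_rfl

/-- The gradient estimate of an iteration is accurate with probability at least `1 - ζ`, given the
history, if the mini-batch is large enough. -/
lemma IsRun.gradient_accuracy [IsProbabilityMeasure μ] (hrun : IsRun μ ℱ f x₀ m M ε₁ x s ξg ξH)
    (hN : 0 < N) (hf : ObjectiveAssumption f L₀ L₁ L₂) (hε₁ : 0 < ε₁) {β ζ : ℝ} (hβ : 0 < β)
    (hζ : 0 < ζ) (k : ℕ) :
    (∀ᵐ ω ∂μ, ω ∈ executed ε₁ s k → ω ∈ gradBatchLarge m L₁ β ε₁ ζ x s ξg k →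
        1 - ζ ≤ (μ⟦gradAccurate f m β ε₁ x s ξg k|ℱ k⟧) ω) ∧
      ((∀ᵐ ω ∂μ, ω ∈ executed ε₁ s k → ω ∈ gradBatchLarge m L₁ β ε₁ ζ x s ξg k) →
        1 - ζ ≤ μ.real {ω | ω ∈ executed ε₁ s k → ω ∈ gradAccurate f m β ε₁ x s ξg k}) := by
  by_cases hk : k % m = 0
  -- At the start of an inner loop the estimate is exact.
  · have huniv : gradAccurate f m β ε₁ x s ξg k = Set.univ := by
      refine Set.eq_univ_of_forall fun ω => ?_
      simp only [gradAccurate, gradEst, hk, if_true, sub_self, norm_zero, Set.mem_ofPred_eq]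
      positivity
    exact accuracy_of_eq_univ (E := executed ε₁ s k)
      (G := gradBatchLarge m L₁ β ε₁ ζ x s ξg k) (ℱ.le k) huniv hζ
  have hpair := (hrun.x_measurable k).prodMk (hrun.measurable_anchor k)
  have hs : Measurable[ℱ k] fun ω => ‖s k ω‖ := measurable_norm.comp (hrun.s_measurable k)
  have hδ : Measurable[ℱ k] fun ω => ‖x k ω - anchor m x k ω‖ :=
    (continuous_fst.sub continuous_snd).norm.measurable.comp hpair
  have herr (l : List (Fin N)) : Measurable[ℱ k] fun ω =>
      ‖vrGradient f (x k ω) (anchor m x k ω) l - ∇ (objective f) (x k ω)‖ :=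
    ((continuous_vrGradient_error hf l).measurable.comp hpair :)
  -- This identifies the first denominator of the batch-size bound with the square of the tolerance.
  have hmax (ω : Ω) : max (‖s k ω‖ ^ 2) (ε₁ ^ 2) ^ 2 = max (‖s k ω‖ ^ 4) (ε₁ ^ 4) := by
    rw [(pow_left_monotoneOn (n := 2)).map_max (sq_nonneg ‖s k ω‖) (sq_nonneg ε₁),
      ← pow_mul, ← pow_mul]
  have htol : Measurable[ℱ k] fun ω => β * max (‖s k ω‖ ^ 2) (ε₁ ^ 2) :=
    ((hs.pow_const 2).max measurable_const).const_mul β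
  have hsize : Measurable[ℱ k] fun ω =>
      (8 * (L₁ : ℝ) ^ 2 / (β ^ 2 * max (‖s k ω‖ ^ 4) (ε₁ ^ 4))
          * ‖x k ω - anchor m x k ω‖ ^ 2
        + 4 * (L₁ : ℝ) / (3 * β * max (‖s k ω‖ ^ 2) (ε₁ ^ 2)) * ‖x k ω - anchor m x k ω‖)
        * Real.log (2 * ((d : ℝ) + 1) / ζ) :=
    ((((((hs.pow_const 4).max measurable_const).const_mul _).const_div _).mul (hδ.pow_const 2)).add
      (((((hs.pow_const 2).max measurable_const).const_mul _).const_div _).mul hδ)).mul_const _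
  have h := (hrun.sample_gradient k hk).accuracy (ℱ.le k) hN (hrun.measurableSet_executed k)
    (fun l => ℱ.le (k + 1) _ (hrun.ξg_measurable k hk l)) herr htol hsize hζ
    (fun hζ1 ω n hn => card_inaccurate_vrGradient_le hN hf (x k ω) (anchor m x k ω)
      (by positivity) hζ hζ1 (by rw [← hmax] at hn; convert hn using 2; ring))
  simpa only [gradBatchLarge, gradAccurate, gradEst, hk, if_false, ne_eq, not_false_eq_true,
    true_implies, forall_const, Set.mem_ofPred_eq] using h

/-- The Hessian estimate of an iteration is accurate with probability at least `1 - ζ`, given the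
history, if the mini-batch is large enough. -/
lemma IsRun.hessian_accuracy [IsProbabilityMeasure μ] (hrun : IsRun μ ℱ f x₀ m M ε₁ x s ξg ξH)
    (hN : 0 < N) (hf : ObjectiveAssumption f L₀ L₁ L₂) (hε₁ : 0 < ε₁) {α ζ : ℝ} (hα : 0 < α)
    (hζ : 0 < ζ) (k : ℕ) :
    (∀ᵐ ω ∂μ, ω ∈ executed ε₁ s k → ω ∈ hessBatchLarge m L₂ α ε₁ ζ x s ξH k →
        1 - ζ ≤ (μ⟦hessAccurate f m α ε₁ x s ξH k|ℱ k⟧) ω) ∧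
      ((∀ᵐ ω ∂μ, ω ∈ executed ε₁ s k → ω ∈ hessBatchLarge m L₂ α ε₁ ζ x s ξH k) →
        1 - ζ ≤ μ.real {ω | ω ∈ executed ε₁ s k → ω ∈ hessAccurate f m α ε₁ x s ξH k}) := by
  by_cases hk : k % m = 0
  · have huniv : hessAccurate f m α ε₁ x s ξH k = Set.univ := by
      refine Set.eq_univ_of_forall fun ω => ?_
      simp only [hessAccurate, hessEst, hk, if_true, sub_self, norm_zero, Set.mem_ofPred_eq]
      positivity
    exact accuracy_of_eq_univ (E := executed ε₁ s k)
      (G := hessBatchLarge m L₂ α ε₁ ζ x s ξH k) (ℱ.le k) huniv hζ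
  have hpair := (hrun.x_measurable k).prodMk (hrun.measurable_anchor k)
  have hs : Measurable[ℱ k] fun ω => ‖s k ω‖ := measurable_norm.comp (hrun.s_measurable k)
  have hδ : Measurable[ℱ k] fun ω => ‖x k ω - anchor m x k ω‖ :=
    (continuous_fst.sub continuous_snd).norm.measurable.comp hpair
  have herr (l : List (Fin N)) : Measurable[ℱ k] fun ω =>
      ‖vrHessian f (x k ω) (anchor m x k ω) l - hessian (objective f) (x k ω)‖ :=
    ((continuous_vrHessian_error hf l).measurable.comp hpair :)
  have hmax (ω : Ω) : max ‖s k ω‖ ε₁ ^ 2 = max (‖s k ω‖ ^ 2) (ε₁ ^ 2) :=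
    (pow_left_monotoneOn (n := 2)).map_max (norm_nonneg (s k ω)) hε₁.le
  have htol : Measurable[ℱ k] fun ω => α * max ‖s k ω‖ ε₁ :=
    (hs.max measurable_const).const_mul α
  have hsize : Measurable[ℱ k] fun ω =>
      (8 * (L₂ : ℝ) ^ 2 / (α ^ 2 * max (‖s k ω‖ ^ 2) (ε₁ ^ 2))
          * ‖x k ω - anchor m x k ω‖ ^ 2
        + 4 * (L₂ : ℝ) / (3 * α * max ‖s k ω‖ ε₁) * ‖x k ω - anchor m x k ω‖)
        * Real.log (4 * (d : ℝ) / ζ) :=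
    ((((((hs.pow_const 2).max measurable_const).const_mul _).const_div _).mul (hδ.pow_const 2)).add
      ((((hs.max measurable_const).const_mul _).const_div _).mul hδ)).mul_const _
  have h := (hrun.sample_hessian k hk).accuracy (ℱ.le k) hN (hrun.measurableSet_executed k)
    (fun l => ℱ.le (k + 1) _ (hrun.ξH_measurable k hk l)) herr htol hsize hζ
    (fun hζ1 ω n hn => card_inaccurate_vrHessian_le hN hf (x k ω) (anchor m x k ω)
      (by positivity) hζ hζ1 (by rw [← hmax] at hn; convert hn using 2; ring))
  simpa only [hessBatchLarge, hessAccurate, hessEst, hk, if_false, ne_eq, not_false_eq_true,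
    true_implies, forall_const, Set.mem_ofPred_eq] using h

end Accuracy

end SVRC

theorem theorem2 {Ω : Type*} [mΩ : MeasurableSpace Ω] (μ : Measure Ω) [IsProbabilityMeasure μ]
    (ℱ : Filtration ℕ mΩ) {d N : ℕ} (hN : 0 < N) (f : Fin N → SVRC.Vec d → ℝ) (L₀ L₁ L₂ : ℝ≥0)
    (hf : SVRC.ObjectiveAssumption f L₀ L₁ L₂)
    (x₀ : SVRC.Vec d) (m : ℕ) (hm : 0 < m) (M ε₁ : ℝ) (hM : 0 < M) (hε₁ : 0 < ε₁)
    (x s : ℕ → Ω → SVRC.Vec d) (ξg ξH : ℕ → Ω → List (Fin N))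
    (hrun : SVRC.IsRun μ ℱ f x₀ m M ε₁ x s ξg ξH)
    (α β ζ : ℝ) (hα : 0 < α) (hβ : 0 < β) (hζ : 0 < ζ) (k : ℕ) :
    ((∀ᵐ ω ∂μ, ω ∈ SVRC.executed ε₁ s k → ω ∈ SVRC.gradBatchLarge m L₁ β ε₁ ζ x s ξg k →
        1 - ζ ≤ (μ⟦SVRC.gradAccurate f m β ε₁ x s ξg k|ℱ k⟧) ω) ∧
      ((∀ᵐ ω ∂μ, ω ∈ SVRC.executed ε₁ s k → ω ∈ SVRC.gradBatchLarge m L₁ β ε₁ ζ x s ξg k) →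
        1 - ζ ≤ μ.real
          {ω | ω ∈ SVRC.executed ε₁ s k → ω ∈ SVRC.gradAccurate f m β ε₁ x s ξg k})) ∧
    ((∀ᵐ ω ∂μ, ω ∈ SVRC.executed ε₁ s k → ω ∈ SVRC.hessBatchLarge m L₂ α ε₁ ζ x s ξH k →
        1 - ζ ≤ (μ⟦SVRC.hessAccurate f m α ε₁ x s ξH k|ℱ k⟧) ω) ∧
      ((∀ᵐ ω ∂μ, ω ∈ SVRC.executed ε₁ s k → ω ∈ SVRC.hessBatchLarge m L₂ α ε₁ ζ x s ξH k) →
        1 - ζ ≤ μ.real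
          {ω | ω ∈ SVRC.executed ε₁ s k → ω ∈ SVRC.hessAccurate f m α ε₁ x s ξH k})) := by
  exact ⟨hrun.gradient_accuracy hN hf hε₁ hβ hζ k, hrun.hessian_accuracy hN hf hε₁ hα hζ k⟩
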